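/- A metrical task system (MTS) consists of an $N$-point pseudometric space $({\cal X},d)$, $N\ge 1$, of states and a collection ${\cal L}\subseteq[0,1]^{\cal X}$ of loss vectors; let $D=\max_{x,y\in{\cal X}}d(x,y)$. A (randomized) online algorithm with known time horizon $T$ is, at each step $t=1,\dots,T$, first given a loss vector $l_t\in{\cal L}$ and then chooses, possibly at random and using only $l_1,\dots,l_t$ and its earlier choices, a state $i_t\in{\cal X}$. It has regret at most $R$ on the interval $I=\{t_0+1,\dots,t_0+k\}\subseteq[1,T]$ if, for every sequence $l_1,\dots,l_T\in{\cal L}$ fixed in advance, $$\mathbb{E}\Big[\sum_{t\in I}l_t(i_t)+\sum_{t\in I\setminus\{t_0+1\}}d(i_t,i_{t-1})\Big]\le\min_{x\in{\cal X}}\sum_{t\in I}l_t(x)+R,$$ where the expectation is over the randomization of the algorithm. Corollary. There is a universal constant $C>0$ such that for every MTS with $N$ states and diameter $D$ and every time horizon $T$ there is an online algorithm whose regret on every interval $I\subseteq[1,T]$ (simultaneously) is at most $C\sqrt{(D+1)\,|I|\,\log(NT)}$. -/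

import Mathlib

/-- A metrical task system on the finite nonempty pseudometric space `X` of states: the metric is
that of `X`, and `losses` is the collection of admissible loss vectors, all with values
in `[0, 1]`. -/
structure MetricalTaskSystem (X : Type*) [PseudoMetricSpace X] [Fintype X] [Nonempty X] where
  losses : Set (X → ℝ)
  mem_Icc : ∀ l ∈ losses, ∀ x, l x ∈ Set.Icc (0 : ℝ) 1

namespace MetricalTaskSystem

variable {X : Type*} [PseudoMetricSpace X] [Fintype X] [Nonempty X]

/-- A randomized online algorithm with known time horizon `T`. Step `t : Fin T` is the
`(t + 1)`-st time step. The state at that step is drawn from a distribution which may depend on the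
loss vectors revealed so far, the current one included, and on the states chosen at all
earlier steps. -/
structure OnlineAlgorithm (M : MetricalTaskSystem X) (T : ℕ) where
  next : (t : Fin T) → (seen : Fin (t.val + 1) → M.losses) → (past : Fin t.val → X) → PMF X

namespace OnlineAlgorithm

variable {M : MetricalTaskSystem X} {T : ℕ}

/-- The joint law of the states chosen in the first `n` steps, when the loss sequence is `l`. -/
noncomputable def law (A : M.OnlineAlgorithm T) (l : Fin T → M.losses) :
    (n : ℕ) → n ≤ T → PMF (Fin n → X)
  | 0, _ => PMF.pure Fin.elim0
  | n + 1, h =>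
      (A.law l n (Nat.le_of_succ_le h)).bind fun past =>
        (A.next ⟨n, h⟩ (fun s => l (Fin.castLE h s)) past).map fun x =>
          (Fin.snoc past x : Fin (n + 1) → X)

/-- Expectation of a function of the whole sequence of states chosen by the algorithm. -/
noncomputable def expect (A : M.OnlineAlgorithm T) (l : Fin T → M.losses)
    (f : (Fin T → X) → ℝ) : ℝ :=
  ∑ i : Fin T → X, (A.law l T le_rfl i).toReal * f i

end OnlineAlgorithm

/-- The time interval `{t₀ + 1, …, t₀ + k}`, in terms of the zero-based indices `t₀, …, t₀ + k - 1`
of its steps. -/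
def interval (T t₀ k : ℕ) : Finset (Fin T) :=
  Finset.univ.filter fun t => t₀ ≤ t.val ∧ t.val < t₀ + k

/-- The interval without its first step. -/
def intervalTail (T t₀ k : ℕ) : Finset (Fin T) :=
  Finset.univ.filter fun t => t₀ + 1 ≤ t.val ∧ t.val < t₀ + k

/-- The step before `t` (only used for steps `t` that are not the first one). -/
def prevStep {T : ℕ} (t : Fin T) : Fin T :=
  ⟨t.val - 1, lt_of_le_of_lt (Nat.sub_le _ _) t.isLt⟩

/-- Total cost of the state sequence `i` on an interval: the losses at all its steps, plus the
movement costs at all its steps but the first. -/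
noncomputable def cost {M : MetricalTaskSystem X} {T : ℕ} (l : Fin T → M.losses) (t₀ k : ℕ)
    (i : Fin T → X) : ℝ :=
  ∑ t ∈ interval T t₀ k, (l t).val (i t) +
    ∑ t ∈ intervalTail T t₀ k, dist (i t) (i (prevStep t))

/-- The loss on an interval of the best fixed state. -/
noncomputable def bestFixed {M : MetricalTaskSystem X} {T : ℕ} (l : Fin T → M.losses)
    (t₀ k : ℕ) : ℝ :=
  Finset.univ.inf' Finset.univ_nonempty fun x : X => ∑ t ∈ interval T t₀ k, (l t).val x

/-- `A` has regret at most `R` on the interval `{t₀ + 1, …, t₀ + k}`: for every sequence of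
admissible loss vectors, fixed in advance. -/
def OnlineAlgorithm.HasRegretBound {M : MetricalTaskSystem X} {T : ℕ} (A : M.OnlineAlgorithm T)
    (t₀ k : ℕ) (R : ℝ) : Prop :=
  ∀ l : Fin T → M.losses, A.expect l (cost l t₀ k) ≤ bestFixed l t₀ k + R

end MetricalTaskSystem

/-! Only the distribution of the state at each time matters: moving between consecutive
distributions along a maximal coupling costs at most `D` times their total variation distance. So
it suffices to find a full-information learner, predicting before it sees the loss, with small
regret plus `D` times the drift of its play.

Fixed share on experts with individual learning rates `η e`, playing `e` with probability
proportional to `η e * w e`, has drift at most the played average of `η` (up to the sharing), and on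
every interval of length `k` its regret against `e` is at most a multiple of
`η e * k + log (n / share) / η e`, where `n` is the number of experts. Take a copy of every state at
each rate `1 / (3 (D + 1) m)`, `1 ≤ m ≤ T + 1`, and charge the copies with index `m` the extra loss
`1 / m`. This pays for the drift, so for each `m` the total cost exceeds that of a fixed state by
`O(k / m + (D + 1) m log (N T))`. On an interval of length `k`, the choice of `m` near
`√(k / ((D + 1) log (N T)))` balances the two terms; the algorithm itself does not depend on it,
hence the bound on all intervals at once. -/

namespace MetricalTaskSystem

section FiniteDistributions

variable {α β : Type*} [Fintype α]

/-- The expectation of a real function under a probability mass function on a finite type. -/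
noncomputable def expectation (μ : PMF α) (f : α → ℝ) : ℝ :=
  ∑ a, (μ a).toReal * f a

lemma sum_toReal_apply (μ : PMF α) : ∑ a, (μ a).toReal = 1 := by
  rw [← ENNReal.toReal_sum fun a _ => μ.apply_ne_top a, ← tsum_fintype (L := .unconditional α),
    μ.tsum_coe, ENNReal.toReal_one]

lemma toReal_bind_apply (μ : PMF α) (κ : α → PMF β) (b : β) :
    (μ.bind κ b).toReal = expectation μ fun a => (κ a b).toReal := by
  rw [PMF.bind_apply, tsum_fintype, ENNReal.toReal_sum
    fun a _ => ENNReal.mul_ne_top (μ.apply_ne_top a) ((κ a).apply_ne_top b)]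
  simp only [expectation, ENNReal.toReal_mul]

lemma expectation_pure (a : α) (f : α → ℝ) : expectation (PMF.pure a) f = f a := by
  classical
  simp [expectation, PMF.pure_apply, apply_ite ENNReal.toReal]

lemma expectation_add (μ : PMF α) (f g : α → ℝ) :
    expectation μ (fun a => f a + g a) = expectation μ f + expectation μ g := by
  simp only [expectation, mul_add, Finset.sum_add_distrib]

lemma expectation_sum {ι : Type*} (μ : PMF α) (s : Finset ι) (f : ι → α → ℝ) :
    expectation μ (fun a => ∑ i ∈ s, f i a) = ∑ i ∈ s, expectation μ (f i) := by
  simp only [expectation, Finset.mul_sum]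
  exact Finset.sum_comm

/-- The probability mass function with real point masses `q`. Off the standard simplex it takes
the junk value of a point mass. -/
noncomputable def ofReal [Nonempty α] (q : α → ℝ) : PMF α :=
  open Classical in
  if hq : q ∈ stdSimplex ℝ α then
    PMF.ofFintype (fun a => ENNReal.ofReal (q a)) (by
      rw [← ENNReal.ofReal_sum_of_nonneg fun a _ => hq.1 a, hq.2, ENNReal.ofReal_one])
  else PMF.pure (Classical.arbitrary α)

lemma toReal_ofReal_apply [Nonempty α] {q : α → ℝ} (hq : q ∈ stdSimplex ℝ α) (a : α) :
    (ofReal q a).toReal = q a := by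
  rw [ofReal, dif_pos hq, PMF.ofFintype_apply, ENNReal.toReal_ofReal (hq.1 a)]

lemma sum_mul_mem_Icc {q f : α → ℝ} {a b : ℝ} (hq : q ∈ stdSimplex ℝ α)
    (hf : ∀ e, f e ∈ Set.Icc a b) : ∑ e, q e * f e ∈ Set.Icc a b :=
  (convex_Icc a b).sum_mem (fun e _ => hq.1 e) hq.2 fun e _ => hf e

variable [Fintype β]

lemma expectation_bind (μ : PMF α) (κ : α → PMF β) (f : β → ℝ) :
    expectation (μ.bind κ) f = expectation μ fun a => expectation (κ a) f := by
  simp only [expectation, toReal_bind_apply, Finset.sum_mul, Finset.mul_sum, mul_assoc]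
  exact Finset.sum_comm

lemma expectation_map (μ : PMF α) (g : α → β) (f : β → ℝ) :
    expectation (μ.map g) f = expectation μ (f ∘ g) := by
  simp only [← PMF.bind_pure_comp, expectation_bind, Function.comp_def, expectation_pure]

end FiniteDistributions

section TotalVariation

variable {α β : Type*}

/-- The amount by which the mass that `μ` gives to `a` exceeds the mass that `ν` gives to it. -/
noncomputable def surplus (μ ν : PMF α) (a : α) : ℝ :=
  ((μ a).toReal - (ν a).toReal)⁺

lemma surplus_nonneg (μ ν : PMF α) (a : α) : 0 ≤ surplus μ ν a :=
  posPart_nonneg _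

lemma surplus_le (μ ν : PMF α) (a : α) : surplus μ ν a ≤ (μ a).toReal :=
  sup_le (sub_le_self _ ENNReal.toReal_nonneg) ENNReal.toReal_nonneg

lemma toReal_sub_surplus (μ ν : PMF α) (a : α) :
    (μ a).toReal - surplus μ ν a = (ν a).toReal - surplus ν μ a := by
  have h := posPart_sub_negPart ((μ a).toReal - (ν a).toReal)
  rw [← posPart_neg, neg_sub] at h
  rw [surplus, surplus]
  linarith

variable [Fintype α] [Fintype β]

/-- The total variation distance. Only the surplus of `μ` over `ν` is counted, which equals
the surplus of `ν` over `μ`. -/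
noncomputable def tvDist (μ ν : PMF α) : ℝ :=
  ∑ a, surplus μ ν a

lemma tvDist_nonneg (μ ν : PMF α) : 0 ≤ tvDist μ ν :=
  Finset.sum_nonneg fun a _ => surplus_nonneg μ ν a

lemma tvDist_self (μ : PMF α) : tvDist μ μ = 0 := by
  simp only [tvDist, surplus, sub_self, posPart_zero, Finset.sum_const_zero]

lemma tvDist_comm (μ ν : PMF α) : tvDist μ ν = tvDist ν μ := by
  have h := Finset.sum_congr rfl fun a (_ : a ∈ Finset.univ) => toReal_sub_surplus μ ν a
  simp only [Finset.sum_sub_distrib, sum_toReal_apply] at h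
  exact sub_right_injective h

lemma surplus_eq_zero_of_tvDist_eq_zero {μ ν : PMF α} (h : tvDist μ ν = 0) (a : α) :
    surplus μ ν a = 0 :=
  (Finset.sum_eq_zero_iff_of_nonneg fun a _ => surplus_nonneg μ ν a).1 h a (Finset.mem_univ a)

lemma tvDist_bind_le (μ ν : PMF α) (κ : α → PMF β) :
    tvDist (μ.bind κ) (ν.bind κ) ≤ tvDist μ ν := by
  calc tvDist (μ.bind κ) (ν.bind κ) ≤ ∑ b, ∑ a, surplus μ ν a * (κ a b).toReal := by
        refine Finset.sum_le_sum fun b _ => sup_le ?_ (Finset.sum_nonneg fun a _ =>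
          mul_nonneg (surplus_nonneg μ ν a) ENNReal.toReal_nonneg)
        simp only [toReal_bind_apply, expectation, ← Finset.sum_sub_distrib, ← sub_mul]
        gcongr
        exact le_posPart _
    _ = tvDist μ ν := by
        rw [Finset.sum_comm]
        simp only [← Finset.mul_sum, sum_toReal_apply, mul_one, tvDist]

lemma sum_posPart_div_sum_sub_le [Nonempty α] {u v : α → ℝ} (hu : ∀ a, 0 < u a)
    (hv : ∀ a, 0 < v a) :
    ∑ a, (u a / ∑ b, u b - v a / ∑ b, v b)⁺ ≤ (∑ a, |v a - u a|) / ∑ b, u b := by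
  have hU : 0 < ∑ b, u b := Finset.sum_pos (fun a _ => hu a) Finset.univ_nonempty
  have hV : 0 < ∑ b, v b := Finset.sum_pos (fun a _ => hv a) Finset.univ_nonempty
  have hVU : ∑ b, v b - ∑ b, u b ≤ ∑ a, (v a - u a)⁺ := by
    rw [← Finset.sum_sub_distrib]
    exact Finset.sum_le_sum fun a _ => le_posPart _
  have hgain : 0 ≤ ∑ a, (v a - u a)⁺ := Finset.sum_nonneg fun a _ => posPart_nonneg _
  generalize ∑ b, u b = U at *
  generalize hVdef : ∑ b, v b = V at *
  generalize hgainDef : ∑ a, (v a - u a)⁺ = gain at *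
  have hterm (a : α) : (u a / U - v a / V)⁺ ≤ (v a - u a)⁻ / U + v a / V * (gain / U) := by
    have hva := (hv a).le
    refine sup_le ?_ (by positivity)
    calc u a / U - v a / V = (-(v a - u a)) / U + v a / V * ((V - U) / U) := by
          field_simp
          ring
      _ ≤ (v a - u a)⁻ / U + v a / V * (gain / U) := by
          gcongr
          exact neg_le_negPart _
  calc ∑ a, (u a / U - v a / V)⁺
      ≤ ∑ a, ((v a - u a)⁻ / U + v a / V * (gain / U)) := Finset.sum_le_sum fun a _ => hterm a
    _ = (∑ a, ((v a - u a)⁺ + (v a - u a)⁻)) / U := by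
        rw [Finset.sum_add_distrib, Finset.sum_add_distrib, ← Finset.sum_mul, ← Finset.sum_div,
          ← Finset.sum_div, hVdef, div_self hV.ne', hgainDef]
        ring
    _ = (∑ a, |v a - u a|) / U := by simp only [posPart_add_negPart]

end TotalVariation

section Transport

variable {α : Type*} [Fintype α] [Nonempty α]

open Classical in
/-- The maximal coupling of `μ` and `ν`, as a kernel from `μ` to `ν`: a point stays put with the
largest probability that `ν` allows, and otherwise is resampled from the surplus of `ν` over `μ`. -/
noncomputable def transport (μ ν : PMF α) (a : α) : PMF α :=
  ofReal fun b => ((if b = a then (μ a).toReal - surplus μ ν a else 0) +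
    surplus μ ν a * (surplus ν μ b / tvDist μ ν)) / (μ a).toReal

open Classical in
lemma toReal_mul_transport_apply (μ ν : PMF α) (a b : α) :
    (μ a).toReal * (transport μ ν a b).toReal =
      (if b = a then (μ a).toReal - surplus μ ν a else 0) +
        surplus μ ν a * (surplus ν μ b / tvDist μ ν) := by
  have hstay := sub_nonneg.2 (surplus_le μ ν a)
  have hmove : surplus μ ν a * (tvDist μ ν / tvDist μ ν) = surplus μ ν a := by
    rcases eq_or_ne (tvDist μ ν) 0 with h | h
    · rw [surplus_eq_zero_of_tvDist_eq_zero h, zero_mul]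
    · rw [div_self h, mul_one]
  rcases (ENNReal.toReal_nonneg : 0 ≤ (μ a).toReal).eq_or_lt with ha | ha
  · have hsurplus : surplus μ ν a = 0 := le_antisymm (by linarith) (surplus_nonneg μ ν a)
    simp only [← ha, hsurplus, zero_mul, sub_self, ite_self, add_zero]
  rw [transport, toReal_ofReal_apply, mul_div_cancel₀ _ ha.ne']
  refine ⟨fun c => div_nonneg (add_nonneg ?_ ?_) ha.le, ?_⟩
  · split_ifs
    exacts [hstay, le_rfl]
  · exact mul_nonneg (surplus_nonneg μ ν a) (div_nonneg (surplus_nonneg ν μ c) (tvDist_nonneg μ ν))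
  · rw [← Finset.sum_div, Finset.sum_add_distrib, Finset.sum_ite_eq', if_pos (Finset.mem_univ a),
      ← Finset.mul_sum, ← Finset.sum_div, ← tvDist, tvDist_comm ν μ, hmove, sub_add_cancel,
      div_self ha.ne']

lemma bind_transport (μ ν : PMF α) : μ.bind (transport μ ν) = ν := by
  classical
  ext b
  rw [← ENNReal.toReal_eq_toReal_iff' (PMF.apply_ne_top _ b) (ν.apply_ne_top b), toReal_bind_apply]
  have hgain : tvDist μ ν * (surplus ν μ b / tvDist μ ν) = surplus ν μ b :=
    mul_div_cancel_of_imp' fun h => surplus_eq_zero_of_tvDist_eq_zero (tvDist_comm μ ν ▸ h) b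
  simp only [expectation, toReal_mul_transport_apply, Finset.sum_add_distrib, ← Finset.sum_mul,
    Finset.sum_ite_eq, Finset.mem_univ, if_true]
  rw [← tvDist, hgain, toReal_sub_surplus, sub_add_cancel]

lemma expectation_transport_le (μ ν : PMF α) {c : α → α → ℝ} {D : ℝ}
    (hc : ∀ a, c a a = 0) (hD : ∀ a b, c a b ≤ D) :
    expectation μ (fun a => expectation (transport μ ν a) (c a)) ≤ D * tvDist μ ν := by
  classical
  have hterm (a b : α) : (μ a).toReal * (transport μ ν a b).toReal * c a b ≤
      surplus μ ν a * (surplus ν μ b / tvDist μ ν) * D := by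
    have hmass : 0 ≤ surplus μ ν a * (surplus ν μ b / tvDist μ ν) :=
      mul_nonneg (surplus_nonneg μ ν a) (div_nonneg (surplus_nonneg ν μ b) (tvDist_nonneg μ ν))
    refine le_trans (le_of_eq ?_) (mul_le_mul_of_nonneg_left (hD a b) hmass)
    rw [toReal_mul_transport_apply]
    split_ifs with h
    · rw [h, hc, mul_zero, mul_zero]
    · rw [zero_add]
  calc expectation μ (fun a => expectation (transport μ ν a) (c a))
      = ∑ a, ∑ b, (μ a).toReal * (transport μ ν a b).toReal * c a b := by
        simp only [expectation, Finset.mul_sum, mul_assoc]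
    _ ≤ ∑ a, ∑ b, surplus μ ν a * (surplus ν μ b / tvDist μ ν) * D :=
        Finset.sum_le_sum fun a _ => Finset.sum_le_sum fun b _ => hterm a b
    _ = tvDist μ ν * (tvDist ν μ / tvDist μ ν) * D := by
        simp only [← Finset.sum_mul, ← Finset.mul_sum, ← Finset.sum_div, tvDist]
    _ = D * tvDist μ ν := by
        rw [tvDist_comm ν μ, ← mul_div_assoc, mul_self_div_self, mul_comm]

end Transport

section Padding

variable {X : Type*} [PseudoMetricSpace X] [Fintype X] [Nonempty X] {M : MetricalTaskSystem X}
  {n T t₀ k : ℕ}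

/-- A finite sequence of admissible loss vectors, continued by zero vectors. -/
noncomputable def padLoss (l : Fin n → M.losses) (t : ℕ) : X → ℝ :=
  if h : t < n then (l ⟨t, h⟩).val else 0

lemma padLoss_val (l : Fin T → M.losses) (t : Fin T) : padLoss l t.val = (l t).val :=
  dif_pos t.isLt

lemma padLoss_castLE (l : Fin T → M.losses) (h : n ≤ T) {t : ℕ} (ht : t < n) :
    padLoss (fun s => l (Fin.castLE h s)) t = padLoss l t := by
  rw [padLoss, padLoss, dif_pos ht, dif_pos (ht.trans_le h)]
  rfl

lemma padLoss_mem_Icc (l : Fin T → M.losses) (t : ℕ) (x : X) :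
    padLoss l t x ∈ Set.Icc (0 : ℝ) 1 := by
  unfold padLoss
  split_ifs
  · exact M.mem_Icc _ (l _).2 x
  · exact ⟨le_rfl, zero_le_one⟩

lemma sum_interval (h : t₀ + k ≤ T) (f : ℕ → ℝ) :
    ∑ t ∈ interval T t₀ k, f t.val = ∑ t ∈ Finset.Ico t₀ (t₀ + k), f t := by
  refine (Finset.sum_map _ Fin.valEmbedding f).symm.trans ?_
  congr 1
  ext t
  simp only [interval, Finset.mem_map, Finset.mem_filter, Finset.mem_univ, true_and,
    Fin.valEmbedding_apply, Finset.mem_Ico]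
  exact ⟨fun ⟨_, hs, hst⟩ => hst ▸ hs, fun ht => ⟨⟨t, by omega⟩, ht, rfl⟩⟩

lemma sum_intervalTail_le {f : Fin T → ℝ} {g : ℕ → ℝ} (hg : ∀ t, 0 ≤ g t)
    (hfg : ∀ (t : ℕ) (ht : t + 1 < T), f ⟨t + 1, ht⟩ ≤ g t) :
    ∑ t ∈ intervalTail T t₀ k, f t ≤ ∑ t ∈ Finset.Ico t₀ (t₀ + k), g t := by
  have hprev : Set.InjOn (fun t : Fin T => t.val - 1) (intervalTail T t₀ k) := by
    intro _ hs _ ht hst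
    simp only [intervalTail, Finset.coe_filter, Finset.mem_univ, true_and,
      Set.mem_ofPred_eq] at hs ht hst
    omega
  calc ∑ t ∈ intervalTail T t₀ k, f t ≤ ∑ t ∈ intervalTail T t₀ k, g (t.val - 1) := by
        refine Finset.sum_le_sum fun t ht => ?_
        obtain ⟨_ | _, hlt⟩ := t
        · simp [intervalTail] at ht
        · exact hfg _ hlt
    _ = ∑ s ∈ (intervalTail T t₀ k).image fun t => t.val - 1, g s := (Finset.sum_image hprev).symm
    _ ≤ ∑ t ∈ Finset.Ico t₀ (t₀ + k), g t := by
        refine Finset.sum_le_sum_of_subset_of_nonneg (fun s hs => ?_) fun t _ _ => hg t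
        obtain ⟨t, ht, rfl⟩ := Finset.mem_image.1 hs
        simp only [intervalTail, Finset.mem_filter, Finset.mem_univ, true_and] at ht
        exact Finset.mem_Ico.2 (by omega)

lemma OnlineAlgorithm.hasRegretBound_of_expect_le {A : M.OnlineAlgorithm T} {R : ℝ}
    (h : t₀ + k ≤ T)
    (hA : ∀ (l : Fin T → M.losses) (x : X),
      A.expect l (cost l t₀ k) ≤ ∑ t ∈ Finset.Ico t₀ (t₀ + k), padLoss l t x + R) :
    A.HasRegretBound t₀ k R := by
  intro l
  rw [← sub_le_iff_le_add, bestFixed, Finset.le_inf'_iff]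
  intro x _
  have hsum := sum_interval h fun t => padLoss l t x
  simp only [padLoss_val] at hsum
  rw [hsum, sub_le_iff_le_add]
  exact hA l x

lemma OnlineAlgorithm.HasRegretBound.mono {A : M.OnlineAlgorithm T} {R R' : ℝ}
    (hA : A.HasRegretBound t₀ k R) (hR : R ≤ R') : A.HasRegretBound t₀ k R' :=
  fun l => (hA l).trans (by gcongr)

end Padding

section FollowMarginals

variable {X : Type*} [PseudoMetricSpace X] [Fintype X] [Nonempty X] {M : MetricalTaskSystem X}
  {T : ℕ}

lemma OnlineAlgorithm.law_map_castLE (A : M.OnlineAlgorithm T) (l : Fin T → M.losses) {m n : ℕ}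
    (hmn : m ≤ n) (hn : n ≤ T) :
    (A.law l n hn).map (fun i => i ∘ Fin.castLE hmn) = A.law l m (hmn.trans hn) := by
  induction n, hmn using Nat.le_induction with
  | base => exact PMF.map_id _
  | succ n hmn ih =>
    have hinit (past : Fin n → X) :
        (fun i : Fin (n + 1) → X => i ∘ Fin.castLE (Nat.le_succ_of_le hmn)) ∘ Fin.snoc past =
          Function.const X (past ∘ Fin.castLE hmn) := by
      ext x s
      exact Fin.snoc_castSucc (α := fun _ => X) x past (Fin.castLE hmn s)
    simp only [law, PMF.map_bind, PMF.map_comp, hinit, PMF.map_const]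
    exact ih (Nat.le_of_succ_le hn)

/-- The algorithm that moves from each marginal distribution to the next along the maximal coupling.
The distribution `p l t` of the state at time `t` is meant to depend on the losses before time `t`
only. -/
noncomputable def followMarginals (M : MetricalTaskSystem X) (T : ℕ)
    (p : (ℕ → X → ℝ) → ℕ → PMF X) : M.OnlineAlgorithm T where
  next
    | ⟨0, _⟩, seen, _ => p (padLoss seen) 0
    | ⟨n + 1, _⟩, seen, past =>
        transport (p (padLoss seen) n) (p (padLoss seen) (n + 1)) (past (Fin.last n))

variable {p : (ℕ → X → ℝ) → ℕ → PMF X}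

lemma marginal_padLoss_castLE (hp : ∀ t, DependsOn (fun l => p l t) (Set.Iio t))
    (l : Fin T → M.losses) {t n : ℕ} (ht : t ≤ n) (h : n ≤ T) :
    p (padLoss fun s => l (Fin.castLE h s)) t = p (padLoss l) t :=
  hp t fun _ hs => padLoss_castLE l h (hs.trans_le ht)

lemma law_followMarginals_succ_succ (hp : ∀ t, DependsOn (fun l => p l t) (Set.Iio t))
    (l : Fin T → M.losses) (t : ℕ) (h : t + 2 ≤ T) :
    (followMarginals M T p).law l (t + 2) h =
      ((followMarginals M T p).law l (t + 1) (Nat.le_of_succ_le h)).bind fun past =>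
        (transport (p (padLoss l) t) (p (padLoss l) (t + 1)) (past (Fin.last t))).map
          (Fin.snoc past) := by
  rw [OnlineAlgorithm.law]
  congr 1
  funext past
  change PMF.map _ (transport (p (padLoss fun s => l (Fin.castLE h s)) t)
    (p (padLoss fun s => l (Fin.castLE h s)) (t + 1)) _) = _
  rw [marginal_padLoss_castLE hp l (by omega) h, marginal_padLoss_castLE hp l (by omega) h]

lemma law_followMarginals_map_last (hp : ∀ t, DependsOn (fun l => p l t) (Set.Iio t))
    (l : Fin T → M.losses) (t : ℕ) (h : t + 1 ≤ T) :
    ((followMarginals M T p).law l (t + 1) h).map (fun i => i (Fin.last t)) = p (padLoss l) t := by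
  have hlast (n : ℕ) (past : Fin n → X) :
      (fun i : Fin (n + 1) → X => i (Fin.last n)) ∘ Fin.snoc past = id :=
    funext fun x => Fin.snoc_last (α := fun _ => X) x past
  induction t with
  | zero =>
    simp only [OnlineAlgorithm.law, PMF.pure_bind, PMF.map_comp, hlast, PMF.map_id]
    exact marginal_padLoss_castLE hp l (Nat.zero_le _) h
  | succ t ih =>
    simp only [law_followMarginals_succ_succ hp, PMF.map_bind, PMF.map_comp, hlast, PMF.map_id]
    exact (PMF.bind_map _ (fun i : Fin (t + 1) → X => i (Fin.last t)) (transport _ _)).symm.trans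
      (by rw [ih, bind_transport])

lemma expectation_law_followMarginals (hp : ∀ t, DependsOn (fun l => p l t) (Set.Iio t))
    (l : Fin T → M.losses) (t : Fin T) (f : X → ℝ) :
    (followMarginals M T p).expect l (fun i => f (i t)) = expectation (p (padLoss l) t) f := by
  rw [← law_followMarginals_map_last hp l t t.isLt,
    ← OnlineAlgorithm.law_map_castLE _ l t.isLt le_rfl, PMF.map_comp, expectation_map]
  rfl

lemma expect_dist_followMarginals_le (hp : ∀ t, DependsOn (fun l => p l t) (Set.Iio t))
    (l : Fin T → M.losses) (t : ℕ) (h : t + 1 < T) :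
    (followMarginals M T p).expect l
        (fun i => dist (i ⟨t + 1, h⟩) (i (prevStep ⟨t + 1, h⟩))) ≤
      Metric.diam (Set.univ : Set X) * tvDist (p (padLoss l) t) (p (padLoss l) (t + 1)) := by
  have hpair : (followMarginals M T p).expect l
        (fun i => dist (i ⟨t + 1, h⟩) (i (prevStep ⟨t + 1, h⟩))) =
      expectation ((followMarginals M T p).law l (t + 2) h)
        (fun i => dist (i (Fin.last (t + 1))) (i (Fin.last t).castSucc)) := by
    rw [← OnlineAlgorithm.law_map_castLE _ l h le_rfl, expectation_map]
    rfl
  have hstep : expectation ((followMarginals M T p).law l (t + 2) h)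
        (fun i => dist (i (Fin.last (t + 1))) (i (Fin.last t).castSucc)) =
      expectation (p (padLoss l) t) fun x =>
        expectation (transport (p (padLoss l) t) (p (padLoss l) (t + 1)) x) fun y => dist y x := by
    rw [law_followMarginals_succ_succ hp, expectation_bind,
      ← law_followMarginals_map_last hp l t (Nat.le_of_succ_le h), expectation_map]
    simp only [expectation_map, Function.comp_def, Fin.snoc_last, Fin.snoc_castSucc]
  rw [hpair, hstep]
  exact expectation_transport_le _ _ dist_self fun x y =>
    Metric.dist_le_diam_of_mem Set.finite_univ.isBounded (Set.mem_univ y) (Set.mem_univ x)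

theorem expect_cost_followMarginals_le (hp : ∀ t, DependsOn (fun l => p l t) (Set.Iio t))
    (l : Fin T → M.losses) {t₀ k : ℕ} (h : t₀ + k ≤ T) :
    (followMarginals M T p).expect l (cost l t₀ k) ≤ ∑ t ∈ Finset.Ico t₀ (t₀ + k),
      (expectation (p (padLoss l) t) (padLoss l t) + Metric.diam (Set.univ : Set X) *
        tvDist (p (padLoss l) t) (p (padLoss l) (t + 1))) := by
  have hsplit : (followMarginals M T p).expect l (cost l t₀ k) =
      ∑ t ∈ interval T t₀ k, (followMarginals M T p).expect l (fun i => (l t).val (i t)) +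
        ∑ t ∈ intervalTail T t₀ k,
          (followMarginals M T p).expect l (fun i => dist (i t) (i (prevStep t))) :=
    (expectation_add _ _ _).trans
      (congrArg₂ _ (expectation_sum _ _ _) (expectation_sum _ _ _))
  rw [hsplit, Finset.sum_add_distrib]
  refine add_le_add (le_of_eq ?_) (sum_intervalTail_le
    (fun t => mul_nonneg Metric.diam_nonneg (tvDist_nonneg _ _))
    (expect_dist_followMarginals_le hp l))
  rw [← sum_interval h]
  refine Finset.sum_congr rfl fun t _ => ?_
  rw [expectation_law_followMarginals hp l t, padLoss_val]

end FollowMarginals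

section FixedShare

lemma sub_two_mul_sq_le_log_one_add {y : ℝ} (hy : -(1 / 2) ≤ y) :
    y - 2 * y ^ 2 ≤ Real.log (1 + y) := by
  have hpos : 0 < 1 + y := by linarith
  refine le_trans ?_ (Real.one_sub_inv_le_log_of_pos hpos)
  have hdiff : 1 - (1 + y)⁻¹ - (y - 2 * y ^ 2) = y ^ 2 * (1 + 2 * y) / (1 + y) := by
    field_simp
    ring
  have hnonneg : 0 ≤ y ^ 2 * (1 + 2 * y) / (1 + y) :=
    div_nonneg (mul_nonneg (sq_nonneg y) (by linarith)) hpos.le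
  linarith

/-- The parameters of the fixed-share rule on the set `E` of experts: each expert has its own
learning rate, and at every step the fraction `share` of the total weight is spread uniformly. -/
structure FixedShare (E : Type*) where
  rate : E → ℝ
  rate_pos : ∀ e, 0 < rate e
  rate_le : ∀ e, rate e ≤ 1 / 2
  share : ℝ
  share_pos : 0 < share
  share_le : share ≤ 1 / 2

namespace FixedShare

variable {E : Type*} [Fintype E] (L : FixedShare E)

/-- The distribution over experts played under the weights `w`. It is proportional to
`rate e * w e`, which makes `∑ e, w e * (rate e * excess e)` vanish. -/
noncomputable def play (w : E → ℝ) (e : E) : ℝ :=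
  L.rate e * w e / ∑ e', L.rate e' * w e'

/-- The expected loss of the played distribution minus the loss of the expert `e`. -/
noncomputable def excess (w ℓ : E → ℝ) (e : E) : ℝ :=
  ∑ e', L.play w e' * ℓ e' - ℓ e

/-- The weights after the loss vector `ℓ`: a multiplicative step, then the uniform sharing. -/
noncomputable def update (w ℓ : E → ℝ) (e : E) : ℝ :=
  (1 - L.share) * (w e * (1 + L.rate e * L.excess w ℓ e)) + L.share / Fintype.card E

/-- The weights before step `t`, starting from the uniform ones. -/
noncomputable def weights (ℓ : ℕ → E → ℝ) : ℕ → E → ℝ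
  | 0 => fun _ => 1 / Fintype.card E
  | t + 1 => L.update (weights ℓ t) (ℓ t)

lemma dependsOn_weights (t : ℕ) : DependsOn (fun ℓ => L.weights ℓ t) (Set.Iio t) := by
  intro ℓ ℓ' h
  induction t with
  | zero => rfl
  | succ t ih =>
    have hprev : L.weights ℓ t = L.weights ℓ' t :=
      ih fun s hs => h s (Nat.lt_succ_of_lt hs)
    have hlast : ℓ t = ℓ' t := h t (Nat.lt_succ_self t)
    change L.update (L.weights ℓ t) (ℓ t) = L.update (L.weights ℓ' t) (ℓ' t)
    rw [hprev, hlast]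

variable {w ℓ : E → ℝ}

lemma mul_le_update (e : E) :
    (1 - L.share) * (w e * (1 + L.rate e * L.excess w ℓ e)) ≤ L.update w ℓ e :=
  le_add_of_nonneg_right (div_nonneg L.share_pos.le (Nat.cast_nonneg _))

lemma rate_le_mul_sum {κ : ℝ} (hκ : ∀ e e', L.rate e ≤ κ * L.rate e') (hw : ∀ e, 0 < w e)
    (hsum : ∑ e, w e = 1) (e : E) : L.rate e ≤ κ * ∑ e', L.rate e' * w e' := by
  calc L.rate e = ∑ e', L.rate e * w e' := by rw [← Finset.mul_sum, hsum, mul_one]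
    _ ≤ ∑ e', κ * L.rate e' * w e' :=
        Finset.sum_le_sum fun e' _ => mul_le_mul_of_nonneg_right (hκ e e') (hw e').le
    _ = κ * ∑ e', L.rate e' * w e' := by simp only [mul_assoc, Finset.mul_sum]

variable [Nonempty E]

lemma share_div_card_pos : 0 < L.share / Fintype.card E :=
  div_pos L.share_pos (Nat.cast_pos.2 Fintype.card_pos)

lemma sum_rate_mul_pos (hw : ∀ e, 0 < w e) : 0 < ∑ e, L.rate e * w e :=
  Finset.sum_pos (fun e _ => mul_pos (L.rate_pos e) (hw e)) Finset.univ_nonempty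

lemma play_mem_stdSimplex (hw : ∀ e, 0 < w e) : L.play w ∈ stdSimplex ℝ E := by
  have hZ := L.sum_rate_mul_pos hw
  refine ⟨fun e => div_nonneg (mul_pos (L.rate_pos e) (hw e)).le hZ.le, ?_⟩
  simp only [play]
  rw [← Finset.sum_div, div_self hZ.ne']

lemma abs_excess_le (hw : ∀ e, 0 < w e) (hℓ : ∀ e, ℓ e ∈ Set.Icc (0 : ℝ) 1) (e : E) :
    |L.excess w ℓ e| ≤ 1 :=
  abs_sub_le_of_nonneg_of_le (sum_mul_mem_Icc (L.play_mem_stdSimplex hw) hℓ).1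
    (sum_mul_mem_Icc (L.play_mem_stdSimplex hw) hℓ).2 (hℓ e).1 (hℓ e).2

lemma abs_rate_mul_excess_le (hw : ∀ e, 0 < w e) (hℓ : ∀ e, ℓ e ∈ Set.Icc (0 : ℝ) 1) (e : E) :
    |L.rate e * L.excess w ℓ e| ≤ L.rate e := by
  rw [abs_mul, abs_of_pos (L.rate_pos e)]
  exact mul_le_of_le_one_right (L.rate_pos e).le (L.abs_excess_le hw hℓ e)

lemma neg_half_le_rate_mul_excess (hw : ∀ e, 0 < w e) (hℓ : ∀ e, ℓ e ∈ Set.Icc (0 : ℝ) 1)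
    (e : E) : -(1 / 2) ≤ L.rate e * L.excess w ℓ e :=
  (abs_le.1 ((L.abs_rate_mul_excess_le hw hℓ e).trans (L.rate_le e))).1

lemma sum_mul_rate_mul_excess (hw : ∀ e, 0 < w e) (ℓ : E → ℝ) :
    ∑ e, w e * (L.rate e * L.excess w ℓ e) = 0 := by
  have hplay (e : E) : w e * L.rate e = (∑ e', L.rate e' * w e') * L.play w e := by
    rw [play, mul_div_cancel₀ _ (L.sum_rate_mul_pos hw).ne', mul_comm]
  simp only [← mul_assoc, hplay, excess]
  simp only [mul_assoc, ← Finset.mul_sum, mul_sub, Finset.sum_sub_distrib, ← Finset.sum_mul,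
    (L.play_mem_stdSimplex hw).2, one_mul, sub_self]

lemma sum_update (hw : ∀ e, 0 < w e) (hsum : ∑ e, w e = 1) (ℓ : E → ℝ) :
    ∑ e, L.update w ℓ e = 1 := by
  simp only [update, mul_add, mul_one, Finset.sum_add_distrib, ← Finset.mul_sum,
    L.sum_mul_rate_mul_excess hw ℓ, hsum, Finset.sum_const, Finset.card_univ, nsmul_eq_mul]
  rw [mul_div_cancel₀ _ (Nat.cast_ne_zero.2 Fintype.card_ne_zero)]
  ring

lemma share_div_card_le_update (hw : ∀ e, 0 < w e) (hℓ : ∀ e, ℓ e ∈ Set.Icc (0 : ℝ) 1) (e : E) :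
    L.share / Fintype.card E ≤ L.update w ℓ e := by
  have hstep := L.neg_half_le_rate_mul_excess hw hℓ e
  have hshare := L.share_le
  exact le_add_of_nonneg_left (mul_nonneg (by linarith) (mul_nonneg (hw e).le (by linarith)))

lemma abs_update_sub_le (hw : ∀ e, 0 < w e) (hℓ : ∀ e, ℓ e ∈ Set.Icc (0 : ℝ) 1) (e : E) :
    |L.update w ℓ e - w e| ≤ L.share * w e + w e * L.rate e + L.share / Fintype.card E := by
  have hstep := L.abs_rate_mul_excess_le hw hℓ e
  have hdamped : |(1 - L.share) * (L.rate e * L.excess w ℓ e)| ≤ L.rate e := by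
    rw [abs_mul]
    refine (mul_le_of_le_one_left (abs_nonneg _) ?_).trans hstep
    exact abs_le.2 ⟨by linarith [L.share_le], by linarith [L.share_pos]⟩
  have hsplit : L.update w ℓ e - w e = -(L.share * w e) +
      w e * ((1 - L.share) * (L.rate e * L.excess w ℓ e)) + L.share / Fintype.card E := by
    rw [update]
    ring
  rw [hsplit]
  refine (abs_add_three _ _ _).trans ?_
  rw [abs_neg, abs_mul (w e), abs_of_pos (hw e), abs_of_pos (mul_pos L.share_pos (hw e)),
    abs_of_nonneg (div_nonneg L.share_pos.le (Nat.cast_nonneg _))]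
  gcongr
  exact (hw e).le

lemma tvDist_play_update_le {κ : ℝ} (hκ : ∀ e e', L.rate e ≤ κ * L.rate e') (hw : ∀ e, 0 < w e)
    (hsum : ∑ e, w e = 1) (hℓ : ∀ e, ℓ e ∈ Set.Icc (0 : ℝ) 1) :
    tvDist (ofReal (L.play w)) (ofReal (L.play (L.update w ℓ))) ≤
      ∑ e, L.play w e * L.rate e + (1 + κ) * L.share := by
  have hZ := L.sum_rate_mul_pos hw
  have hw' (e : E) : 0 < L.update w ℓ e :=
    L.share_div_card_pos.trans_le (L.share_div_card_le_update hw hℓ e)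
  simp only [tvDist, surplus, toReal_ofReal_apply (L.play_mem_stdSimplex hw),
    toReal_ofReal_apply (L.play_mem_stdSimplex hw')]
  refine (sum_posPart_div_sum_sub_le (fun e => mul_pos (L.rate_pos e) (hw e))
    fun e => mul_pos (L.rate_pos e) (hw' e)).trans ?_
  rw [div_le_iff₀ hZ]
  have hterm (e : E) : |L.rate e * L.update w ℓ e - L.rate e * w e| ≤
      L.share * (L.rate e * w e) + L.rate e * w e * L.rate e +
        L.share / Fintype.card E * (κ * ∑ e', L.rate e' * w e') := by
    rw [← mul_sub, abs_mul, abs_of_pos (L.rate_pos e)]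
    have hupdate := mul_le_mul_of_nonneg_left (L.abs_update_sub_le hw hℓ e) (L.rate_pos e).le
    have hrate := mul_le_mul_of_nonneg_left (L.rate_le_mul_sum hκ hw hsum e) L.share_div_card_pos.le
    linarith
  refine (Finset.sum_le_sum fun e _ => hterm e).trans (le_of_eq ?_)
  rw [Finset.sum_add_distrib, Finset.sum_add_distrib, ← Finset.mul_sum, Finset.sum_const,
    Finset.card_univ, nsmul_eq_mul, ← mul_assoc,
    mul_div_cancel₀ _ (Nat.cast_ne_zero.2 Fintype.card_ne_zero)]
  simp only [play, div_mul_eq_mul_div, ← Finset.sum_div]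
  field_simp
  ring

variable {ℓ : ℕ → E → ℝ}

lemma share_div_card_le_weights (hℓ : ∀ t e, ℓ t e ∈ Set.Icc (0 : ℝ) 1) (t : ℕ) (e : E) :
    L.share / Fintype.card E ≤ L.weights ℓ t e := by
  induction t generalizing e with
  | zero =>
    have hshare := L.share_le
    simp only [weights]
    gcongr
    linarith
  | succ t ih =>
    exact L.share_div_card_le_update (fun e => L.share_div_card_pos.trans_le (ih e)) (hℓ t) e

lemma weights_pos (hℓ : ∀ t e, ℓ t e ∈ Set.Icc (0 : ℝ) 1) (t : ℕ) (e : E) :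
    0 < L.weights ℓ t e :=
  L.share_div_card_pos.trans_le (L.share_div_card_le_weights hℓ t e)

lemma sum_weights (hℓ : ∀ t e, ℓ t e ∈ Set.Icc (0 : ℝ) 1) (t : ℕ) :
    ∑ e, L.weights ℓ t e = 1 := by
  induction t with
  | zero => simp [weights]
  | succ t ih => exact L.sum_update (L.weights_pos hℓ t) ih (ℓ t)

lemma weights_le_one (hℓ : ∀ t e, ℓ t e ∈ Set.Icc (0 : ℝ) 1) (t : ℕ) (e : E) :
    L.weights ℓ t e ≤ 1 :=
  L.sum_weights hℓ t ▸ Finset.single_le_sum (fun e' _ => (L.weights_pos hℓ t e').le)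
    (Finset.mem_univ e)

lemma log_weights_add_le (hℓ : ∀ t e, ℓ t e ∈ Set.Icc (0 : ℝ) 1) (t : ℕ) (e : E) :
    Real.log (L.weights ℓ t e) + L.rate e * L.excess (L.weights ℓ t) (ℓ t) e
        - 2 * L.rate e ^ 2 - 2 * L.share ≤ Real.log (L.weights ℓ (t + 1) e) := by
  have hw := L.weights_pos hℓ t
  have hstep := L.neg_half_le_rate_mul_excess hw (hℓ t) e
  have hshare := L.share_pos
  have hshare' := L.share_le
  have hkept : -2 * L.share ≤ Real.log (1 - L.share) := by
    have h := sub_two_mul_sq_le_log_one_add (y := -L.share) (by linarith)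
    rw [← sub_eq_add_neg] at h
    nlinarith
  have hgrowth := sub_two_mul_sq_le_log_one_add hstep
  have hsq := sq_le_sq.2 ((L.abs_rate_mul_excess_le hw (hℓ t) e).trans (le_abs_self _))
  have hmul : 0 < (1 - L.share) * (L.weights ℓ t e *
      (1 + L.rate e * L.excess (L.weights ℓ t) (ℓ t) e)) :=
    mul_pos (by linarith) (mul_pos (hw e) (by linarith))
  have hlog := Real.log_le_log hmul (L.mul_le_update e)
  rw [Real.log_mul (by linarith) (mul_pos (hw e) (by linarith)).ne',
    Real.log_mul (hw e).ne' (by linarith)] at hlog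
  rw [weights]
  linarith

theorem sum_excess_le (hℓ : ∀ t e, ℓ t e ∈ Set.Icc (0 : ℝ) 1) (e : E) (t₀ k : ℕ) :
    ∑ t ∈ Finset.Ico t₀ (t₀ + k), L.excess (L.weights ℓ t) (ℓ t) e ≤
      2 * L.rate e * k + (Real.log (Fintype.card E / L.share) + 2 * L.share * k) / L.rate e := by
  have hrate := L.rate_pos e
  have hstep := Finset.sum_le_sum fun t (_ : t ∈ Finset.Ico t₀ (t₀ + k)) =>
    L.log_weights_add_le hℓ t e
  have hend : Real.log (L.weights ℓ (t₀ + k) e) ≤ 0 :=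
    Real.log_nonpos (L.weights_pos hℓ _ e).le (L.weights_le_one hℓ _ e)
  have hstart : -Real.log (Fintype.card E / L.share) ≤ Real.log (L.weights ℓ t₀ e) := by
    rw [← Real.log_inv, inv_div]
    exact Real.log_le_log L.share_div_card_pos (L.share_div_card_le_weights hℓ t₀ e)
  have htelescope :=
    Finset.sum_Ico_sub (fun t => Real.log (L.weights ℓ t e)) (Nat.le_add_right t₀ k)
  simp only [Finset.sum_sub_distrib, Finset.sum_add_distrib, ← Finset.mul_sum, Finset.sum_const,
    Nat.card_Ico, add_tsub_cancel_left, nsmul_eq_mul] at hstep htelescope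
  rw [← sub_le_iff_le_add', le_div_iff₀ hrate]
  linarith

end FixedShare

end FixedShare

section ConstantAlgorithm

variable {X : Type*} [PseudoMetricSpace X] [Fintype X] [Nonempty X] (M : MetricalTaskSystem X)
  {T t₀ k : ℕ}

lemma expect_cost_followMarginals_pure_le (l : Fin T → M.losses) (x : X) (h : t₀ + k ≤ T) :
    (followMarginals M T fun _ _ => PMF.pure x).expect l (cost l t₀ k) ≤
      ∑ t ∈ Finset.Ico t₀ (t₀ + k), padLoss l t x := by
  refine (expect_cost_followMarginals_le (fun _ _ _ _ => rfl) l h).trans (le_of_eq ?_)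
  simp only [tvDist_self, expectation_pure, mul_zero, add_zero]

lemma hasRegretBound_followMarginals_pure (x : X) (h : t₀ + k ≤ T) :
    (followMarginals M T fun _ _ => PMF.pure x).HasRegretBound t₀ k k := by
  refine OnlineAlgorithm.hasRegretBound_of_expect_le h fun l y => ?_
  refine (expect_cost_followMarginals_pure_le M l x h).trans ?_
  have hle := Finset.sum_le_sum fun t (_ : t ∈ Finset.Ico t₀ (t₀ + k)) =>
    (padLoss_mem_Icc l t x).2
  have hnonneg := Finset.sum_nonneg fun t (_ : t ∈ Finset.Ico t₀ (t₀ + k)) =>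
    (padLoss_mem_Icc l t y).1
  simp only [Finset.sum_const, Nat.card_Ico, add_tsub_cancel_left, nsmul_eq_mul, mul_one] at hle
  linarith

lemma hasRegretBound_zero_of_subsingleton [Subsingleton X] (x : X) (h : t₀ + k ≤ T) :
    (followMarginals M T fun _ _ => PMF.pure x).HasRegretBound t₀ k 0 := by
  refine OnlineAlgorithm.hasRegretBound_of_expect_le h fun l y => ?_
  rw [add_zero, ← Subsingleton.elim x y]
  exact expect_cost_followMarginals_pure_le M l x h

end ConstantAlgorithm

section Multirate

/-- The loss charged to an expert `(j, x)` when the state `x` suffers the loss `l x`. The summand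
`1 / (j + 1)` accounts for the movement of a learner of rate proportional to `1 / (j + 1)`. -/
noncomputable def surrogateLoss {X : Type*} (n : ℕ) (l : X → ℝ) (e : Fin n × X) : ℝ :=
  (l e.2 + 1 / (e.1 + 1)) / 2

/-- The fixed-share rule whose experts are the states at `T + 1` different learning rates. The
scale `s` bounds the cost of a move. -/
noncomputable def multirateLearner (X : Type*) (T : ℕ) {s : ℝ} (hs : 1 ≤ s) :
    FixedShare (Fin (T + 1) × X) where
  rate e := 1 / (3 * s * (e.1 + 1))
  rate_pos e := by positivity
  rate_le e := by
    gcongr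
    nlinarith [(Nat.cast_nonneg e.1.val : (0 : ℝ) ≤ e.1.val)]
  share := 1 / (3 * s * (T + 1) ^ 2)
  share_pos := by positivity
  share_le := by
    gcongr
    nlinarith [(Nat.cast_nonneg T : (0 : ℝ) ≤ T)]

lemma surrogateLoss_mem_Icc {X : Type*} {n : ℕ} {l : X → ℝ} (hl : ∀ x, l x ∈ Set.Icc (0 : ℝ) 1)
    (e : Fin n × X) : surrogateLoss n l e ∈ Set.Icc (0 : ℝ) 1 := by
  have hpenalty : 1 / ((e.1 : ℝ) + 1) ≤ 1 :=
    div_le_one_of_le₀ (by linarith [(Nat.cast_nonneg e.1.val : (0 : ℝ) ≤ e.1.val)]) (by positivity)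
  have hpenalty' : 0 ≤ 1 / ((e.1 : ℝ) + 1) := by positivity
  have hle := (hl e.2).2
  have hnonneg := (hl e.2).1
  rw [surrogateLoss]
  exact ⟨by linarith, by linarith⟩

namespace multirateLearner

variable {X : Type*} {T : ℕ} {s : ℝ} (hs : 1 ≤ s)

lemma rate_le_mul_rate (e e' : Fin (T + 1) × X) :
    (multirateLearner X T hs).rate e ≤ (T + 1) * (multirateLearner X T hs).rate e' := by
  have hj : ((e'.1 : ℕ) : ℝ) + 1 ≤ T + 1 := by exact_mod_cast e'.1.isLt
  calc 1 / (3 * s * (e.1 + 1)) ≤ 1 / (3 * s) :=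
        one_div_le_one_div_of_le (by positivity)
          (le_mul_of_one_le_right (by positivity) (by simp))
    _ = (e'.1 + 1) * (1 / (3 * s * (e'.1 + 1))) := by field_simp
    _ ≤ (T + 1) * (1 / (3 * s * (e'.1 + 1))) := by gcongr

lemma mul_share_le (e : Fin (T + 1) × X) :
    (1 + (T + 1)) * (multirateLearner X T hs).share ≤ 2 * (multirateLearner X T hs).rate e := by
  have hj : ((e.1 : ℕ) : ℝ) + 1 ≤ T + 1 := by exact_mod_cast e.1.isLt
  calc (1 + (T + 1)) * (1 / (3 * s * (T + 1) ^ 2)) ≤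
        (2 * (T + 1)) * (1 / (3 * s * (T + 1) ^ 2)) := by
        gcongr
        linarith [(Nat.cast_nonneg T : (0 : ℝ) ≤ T)]
    _ = 2 * (1 / (3 * s * (T + 1))) := by field_simp
    _ ≤ 2 * (1 / (3 * s * (e.1 + 1))) := by gcongr

lemma two_mul_share_mul_le_one {k : ℕ} (hk : k ≤ T) :
    2 * (multirateLearner X T hs).share * k ≤ 1 := by
  have hkT : (k : ℝ) ≤ T := by exact_mod_cast hk
  have hsq : (2 : ℝ) * k ≤ (T + 1) ^ 2 := by nlinarith [sq_nonneg (T : ℝ)]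
  calc 2 * (1 / (3 * s * (T + 1) ^ 2)) * k = 2 * k / (3 * s * (T + 1) ^ 2) := by ring
    _ ≤ 1 := by
        rw [div_le_one (by positivity)]
        exact hsq.trans (le_mul_of_one_le_left (by positivity) (by linarith))

lemma card_div_share [Fintype X] :
    (Fintype.card (Fin (T + 1) × X) : ℝ) / (multirateLearner X T hs).share =
      3 * s * Fintype.card X * (T + 1) ^ 3 := by
  change (Fintype.card (Fin (T + 1) × X) : ℝ) / (1 / (3 * s * (T + 1) ^ 2)) = _
  rw [Fintype.card_prod, Fintype.card_fin]
  push_cast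
  field_simp

end multirateLearner

/-- The distribution over experts that the multirate learner plays at time `t`, when it is charged
the surrogate losses. -/
noncomputable def multiratePlay {X : Type*} [Fintype X] (T : ℕ) {s : ℝ} (hs : 1 ≤ s)
    (l : ℕ → X → ℝ) (t : ℕ) : Fin (T + 1) × X → ℝ :=
  (multirateLearner X T hs).play
    ((multirateLearner X T hs).weights (fun n => surrogateLoss (T + 1) (l n)) t)

/-- The distribution over states that the multirate learner plays at time `t`. -/
noncomputable def multirateMarginal {X : Type*} [Fintype X] [Nonempty X] (T : ℕ) {s : ℝ}
    (hs : 1 ≤ s) (l : ℕ → X → ℝ) (t : ℕ) : PMF X :=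
  (ofReal (multiratePlay T hs l t)).map Prod.snd

section Marginals

variable {X : Type*} [Fintype X] [Nonempty X] (T : ℕ) {s : ℝ} (hs : 1 ≤ s)

lemma dependsOn_multirateMarginal (t : ℕ) :
    DependsOn (fun l : ℕ → X → ℝ => multirateMarginal T hs l t) (Set.Iio t) := fun l l' h => by
  have hweights := (multirateLearner X T hs).dependsOn_weights t
    fun n (hn : n ∈ Set.Iio t) => congrArg (surrogateLoss (T + 1)) (h n hn)
  exact congrArg (fun w => (ofReal ((multirateLearner X T hs).play w)).map Prod.snd) hweights

variable {l : ℕ → X → ℝ}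

lemma multiratePlay_mem_stdSimplex (hl : ∀ t x, l t x ∈ Set.Icc (0 : ℝ) 1) (t : ℕ) :
    multiratePlay T hs l t ∈ stdSimplex ℝ (Fin (T + 1) × X) :=
  (multirateLearner X T hs).play_mem_stdSimplex
    ((multirateLearner X T hs).weights_pos (fun n => surrogateLoss_mem_Icc (hl n)) t)

lemma expectation_multirateMarginal (hl : ∀ t x, l t x ∈ Set.Icc (0 : ℝ) 1) (t : ℕ)
    (f : X → ℝ) :
    expectation (multirateMarginal T hs l t) f = ∑ e, multiratePlay T hs l t e * f e.2 := by
  rw [multirateMarginal, expectation_map, expectation]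
  simp only [toReal_ofReal_apply (multiratePlay_mem_stdSimplex T hs hl t), Function.comp_apply]

lemma tvDist_multirateMarginal_succ_le (hl : ∀ t x, l t x ∈ Set.Icc (0 : ℝ) 1) (t : ℕ) :
    tvDist (multirateMarginal T hs l t) (multirateMarginal T hs l (t + 1)) ≤
      3 * ∑ e, multiratePlay T hs l t e * (multirateLearner X T hs).rate e := by
  have hℓ := fun n => surrogateLoss_mem_Icc (n := T + 1) (hl n)
  have hplay := multiratePlay_mem_stdSimplex T hs hl t
  have hdrift : tvDist (ofReal (multiratePlay T hs l t)) (ofReal (multiratePlay T hs l (t + 1))) ≤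
      ∑ e, multiratePlay T hs l t e * (multirateLearner X T hs).rate e +
        (1 + (T + 1)) * (multirateLearner X T hs).share :=
    (multirateLearner X T hs).tvDist_play_update_le (multirateLearner.rate_le_mul_rate hs)
      ((multirateLearner X T hs).weights_pos hℓ t) ((multirateLearner X T hs).sum_weights hℓ t)
      (hℓ t)
  have hshare : (1 + (T + 1)) * (multirateLearner X T hs).share ≤
      2 * ∑ e, multiratePlay T hs l t e * (multirateLearner X T hs).rate e := by
    have h := Finset.sum_le_sum fun e (_ : e ∈ Finset.univ) =>
      mul_le_mul_of_nonneg_left (multirateLearner.mul_share_le hs e) (hplay.1 e)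
    rw [← Finset.sum_mul, hplay.2, one_mul] at h
    simpa only [Finset.mul_sum, mul_left_comm] using h
  have hproject := tvDist_bind_le (ofReal (multiratePlay T hs l t))
    (ofReal (multiratePlay T hs l (t + 1))) (PMF.pure ∘ Prod.snd)
  simp only [PMF.bind_pure_comp] at hproject
  exact (hproject.trans hdrift).trans (by linarith)

lemma expectation_add_mul_tvDist_multirateMarginal_le
    (hl : ∀ t x, l t x ∈ Set.Icc (0 : ℝ) 1) {D : ℝ} (hD : D ≤ s) (t : ℕ) :
    expectation (multirateMarginal T hs l t) (l t) +
        D * tvDist (multirateMarginal T hs l t) (multirateMarginal T hs l (t + 1)) ≤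
      2 * ∑ e, multiratePlay T hs l t e * surrogateLoss (T + 1) (l t) e := by
  have hpenalty (e : Fin (T + 1) × X) :
      s * (3 * (multirateLearner X T hs).rate e) = 1 / (e.1 + 1) := by
    change s * (3 * (1 / (3 * s * (e.1 + 1)))) = 1 / (e.1 + 1)
    field_simp
  calc expectation (multirateMarginal T hs l t) (l t) +
        D * tvDist (multirateMarginal T hs l t) (multirateMarginal T hs l (t + 1))
      ≤ ∑ e, multiratePlay T hs l t e * l t e.2 +
        s * (3 * ∑ e, multiratePlay T hs l t e * (multirateLearner X T hs).rate e) := by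
        rw [expectation_multirateMarginal T hs hl]
        gcongr
        · exact tvDist_nonneg _ _
        · exact tvDist_multirateMarginal_succ_le T hs hl t
    _ = 2 * ∑ e, multiratePlay T hs l t e * surrogateLoss (T + 1) (l t) e := by
        simp only [Finset.mul_sum, ← Finset.sum_add_distrib]
        refine Finset.sum_congr rfl fun e _ => ?_
        rw [surrogateLoss, ← hpenalty e]
        ring

lemma sum_multiratePlay_mul_surrogateLoss_le (hl : ∀ t x, l t x ∈ Set.Icc (0 : ℝ) 1)
    (e : Fin (T + 1) × X) {t₀ k : ℕ} (hk : k ≤ T) :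
    ∑ t ∈ Finset.Ico t₀ (t₀ + k),
        2 * ∑ e', multiratePlay T hs l t e' * surrogateLoss (T + 1) (l t) e' ≤
      ∑ t ∈ Finset.Ico t₀ (t₀ + k), l t e.2 + (3 * (k / (e.1 + 1)) +
        6 * s * (e.1 + 1) * (Real.log (3 * s * Fintype.card X * (T + 1) ^ 3) + 1)) := by
  have hexcess := (multirateLearner X T hs).sum_excess_le
    (fun n => surrogateLoss_mem_Icc (n := T + 1) (hl n)) e t₀ k
  rw [multirateLearner.card_div_share hs] at hexcess
  have hsplit : ∑ t ∈ Finset.Ico t₀ (t₀ + k),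
        2 * ∑ e', multiratePlay T hs l t e' * surrogateLoss (T + 1) (l t) e' =
      ∑ t ∈ Finset.Ico t₀ (t₀ + k), l t e.2 + k / (e.1 + 1) +
        2 * ∑ t ∈ Finset.Ico t₀ (t₀ + k), (multirateLearner X T hs).excess
          ((multirateLearner X T hs).weights (fun n => surrogateLoss (T + 1) (l n)) t)
          (surrogateLoss (T + 1) (l t)) e := by
    simp only [FixedShare.excess, surrogateLoss, multiratePlay, Finset.sum_sub_distrib,
      ← Finset.mul_sum, ← Finset.sum_div, Finset.sum_add_distrib, Finset.sum_const, Nat.card_Ico,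
      add_tsub_cancel_left, nsmul_eq_mul]
    ring
  have hrate : 2 * (multirateLearner X T hs).rate e * k ≤ k / (e.1 + 1) := by
    calc 2 * (1 / (3 * s * (e.1 + 1))) * k = 2 / (3 * s) * (k / (e.1 + 1)) := by field_simp
      _ ≤ k / (e.1 + 1) := mul_le_of_le_one_left (by positivity)
          ((div_le_one (by positivity)).2 (by linarith))
  have hinv (y : ℝ) : y / (multirateLearner X T hs).rate e = 3 * s * (e.1 + 1) * y := by
    change y / (1 / (3 * s * (e.1 + 1))) = _
    rw [div_div_eq_mul_div, div_one, mul_comm]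
  have hshare : 3 * s * (e.1 + 1) * (2 * (multirateLearner X T hs).share * k) ≤
      3 * s * (e.1 + 1) :=
    mul_le_of_le_one_right (by positivity) (multirateLearner.two_mul_share_mul_le_one hs hk)
  rw [hinv] at hexcess
  rw [hsplit]
  linarith

end Marginals

section Regret

variable {X : Type*} [PseudoMetricSpace X] [Fintype X] [Nonempty X] (M : MetricalTaskSystem X)
  {T t₀ k : ℕ} {s : ℝ} (hs : 1 ≤ s)

lemma expect_cost_multirate_le (hdiam : Metric.diam (Set.univ : Set X) ≤ s)
    (l : Fin T → M.losses) (h : t₀ + k ≤ T) :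
    (followMarginals M T (multirateMarginal T hs)).expect l (cost l t₀ k) ≤
      ∑ t ∈ Finset.Ico t₀ (t₀ + k), 2 * ∑ e, multiratePlay T hs (padLoss l) t e *
        surrogateLoss (T + 1) (padLoss l t) e :=
  (expect_cost_followMarginals_le (dependsOn_multirateMarginal T hs) l h).trans
    (Finset.sum_le_sum fun t _ =>
      expectation_add_mul_tvDist_multirateMarginal_le T hs (padLoss_mem_Icc l) hdiam t)

theorem hasRegretBound_multirate_two_mul (hdiam : Metric.diam (Set.univ : Set X) ≤ s)
    (h : t₀ + k ≤ T) :
    (followMarginals M T (multirateMarginal T hs)).HasRegretBound t₀ k (2 * k) := by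
  refine OnlineAlgorithm.hasRegretBound_of_expect_le h fun l x => ?_
  have hcost (t : ℕ) : 2 * ∑ e, multiratePlay T hs (padLoss l) t e *
      surrogateLoss (T + 1) (padLoss l t) e ≤ 2 := by
    have hsum := sum_mul_mem_Icc (multiratePlay_mem_stdSimplex T hs (padLoss_mem_Icc l) t)
      (surrogateLoss_mem_Icc (padLoss_mem_Icc l t))
    linarith [hsum.2]
  have hbest : 0 ≤ ∑ t ∈ Finset.Ico t₀ (t₀ + k), padLoss l t x :=
    Finset.sum_nonneg fun t _ => (padLoss_mem_Icc l t x).1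
  have hbound := (expect_cost_multirate_le M hs hdiam l h).trans
    (Finset.sum_le_sum fun t _ => hcost t)
  simp only [Finset.sum_const, Nat.card_Ico, add_tsub_cancel_left, nsmul_eq_mul] at hbound
  linarith

theorem hasRegretBound_multirate (hdiam : Metric.diam (Set.univ : Set X) ≤ s)
    (h : t₀ + k ≤ T) {j : ℕ} (hj : j ≤ T) :
    (followMarginals M T (multirateMarginal T hs)).HasRegretBound t₀ k (3 * (k / (j + 1)) +
      6 * s * (j + 1) * (Real.log (3 * s * Fintype.card X * (T + 1) ^ 3) + 1)) :=
  OnlineAlgorithm.hasRegretBound_of_expect_le h fun l x =>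
    (expect_cost_multirate_le M hs hdiam l h).trans
      (sum_multiratePlay_mul_surrogateLoss_le T hs (padLoss_mem_Icc l)
        (⟨j, Nat.lt_succ_of_le hj⟩, x) ((Nat.le_add_left k t₀).trans h))

end Regret

end Multirate

section Tuning

lemma half_le_log_mul {N T : ℝ} (hN : 2 ≤ N) (hT : 1 ≤ T) : 1 / 2 ≤ Real.log (N * T) := by
  have hNT : 2 ≤ N * T := by nlinarith
  linarith [Real.log_two_gt_d9, Real.log_le_log two_pos hNT]

lemma log_add_one_le_mul_log {N T s : ℝ} (hN : 2 ≤ N) (hT : 1 ≤ T) (hs : 0 < s)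
    (hsT : s ≤ 2 * T) :
    Real.log (3 * s * N * (T + 1) ^ 3) + 1 ≤ 12 * Real.log (N * T) := by
  have hpow : 3 * s * N * (T + 1) ^ 3 ≤ (N * T) ^ 10 := by
    calc 3 * s * N * (T + 1) ^ 3 ≤ 3 * (2 * T) * N * (T + T) ^ 3 := by gcongr
      _ = 48 * (N * T ^ 4) := by ring
      _ ≤ 2 ^ 6 * (N * T ^ 4) := by
          gcongr
          norm_num
      _ ≤ N ^ 6 * (N * T ^ 4) := by gcongr
      _ = N ^ 7 * T ^ 4 := by ring
      _ ≤ N ^ 10 * T ^ 10 := by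
          gcongr
          · linarith
          · norm_num
          · norm_num
      _ = (N * T) ^ 10 := (mul_pow _ _ _).symm
  have hlog := Real.log_le_log (by positivity) hpow
  rw [Real.log_pow] at hlog
  push_cast at hlog
  linarith [half_le_log_mul hN hT]

lemma le_sqrt_mul_self {a b : ℝ} (hb : 0 ≤ b) (hba : b ≤ a) : b ≤ √(a * b) :=
  Real.le_sqrt_of_sq_le (by nlinarith)

lemma exists_nat_div_le_sqrt_mul {B : ℝ} {k : ℕ} (hB : 1 / 2 ≤ B) (hBk : B ≤ k) :
    ∃ j ≤ k, k / (j + 1) ≤ √(B * k) ∧ (j + 1) * B ≤ 2 * √(B * k) := by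
  have hB' : 0 < B := by linarith
  have hk : (0 : ℝ) < k := by linarith
  have hratio : √(k / B) * B = √(B * k) := by
    rw [← Real.sqrt_mul_self hB'.le, ← Real.sqrt_mul (by positivity), Real.sqrt_mul_self hB'.le]
    congr 1
    field_simp
  have hratio' : √(k / B) * √(B * k) = k := by
    rw [← Real.sqrt_mul (by positivity), div_mul_eq_mul_div, mul_left_comm,
      mul_div_cancel_left₀ _ hB'.ne', Real.sqrt_mul_self hk.le]
  have hfloor := Nat.lt_floor_add_one √(k / B)
  refine ⟨⌊√(k / B)⌋₊, ?_, ?_, ?_⟩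
  · rw [← Nat.lt_succ_iff, Nat.floor_lt (by positivity), Real.sqrt_lt' (by positivity),
      div_lt_iff₀ hB']
    push_cast
    nlinarith
  · rw [div_le_iff₀ (by positivity)]
    nlinarith [Real.sqrt_nonneg (B * k)]
  · have hfloor' := Nat.floor_le (Real.sqrt_nonneg (k / B))
    have hsqrt : B ≤ √(B * k) := Real.le_sqrt_of_sq_le (by nlinarith)
    nlinarith

variable {X : Type*} [PseudoMetricSpace X] [Fintype X] [Nonempty X] (M : MetricalTaskSystem X)
  {T t₀ k : ℕ} {s : ℝ} (hs : 1 ≤ s)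

theorem hasRegretBound_multirate_sqrt [Nontrivial X] (hdiam : Metric.diam (Set.univ : Set X) ≤ s)
    (hsT : s * Real.log (Fintype.card X * T) < T) (h : t₀ + k ≤ T) :
    (followMarginals M T (multirateMarginal T hs)).HasRegretBound t₀ k
      (147 * √(s * Real.log (Fintype.card X * T) * k)) := by
  have hN : (2 : ℝ) ≤ Fintype.card X := by exact_mod_cast Fintype.one_lt_card
  have hT : (1 : ℝ) ≤ T :=
    Nat.one_le_cast.2 (Nat.one_le_iff_ne_zero.2 fun hT => by simp [hT] at hsT)
  have hlog := half_le_log_mul hN hT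
  rcases le_total (k : ℝ) (s * Real.log (Fintype.card X * T)) with hk | hk
  · refine (hasRegretBound_multirate_two_mul M hs hdiam h).mono ?_
    linarith [le_sqrt_mul_self k.cast_nonneg hk, Real.sqrt_nonneg
      (s * Real.log (Fintype.card X * T) * k)]
  · obtain ⟨j, hjk, hdiv, hmul⟩ := exists_nat_div_le_sqrt_mul (by nlinarith) hk
    refine (hasRegretBound_multirate M hs hdiam h (by omega : j ≤ T)).mono ?_
    have hlogs := mul_le_mul_of_nonneg_left
      (log_add_one_le_mul_log hN hT (by linarith) (by nlinarith : s ≤ 2 * T))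
      (by positivity : 0 ≤ 6 * s * ((j : ℝ) + 1))
    linarith

end Tuning

end MetricalTaskSystem

theorem mainTheorem6 :
    ∃ C : ℝ, 0 < C ∧
      ∀ (X : Type*) [PseudoMetricSpace X] [Fintype X] [Nonempty X]
        (M : MetricalTaskSystem X) (T : ℕ),
        ∃ A : M.OnlineAlgorithm T, ∀ t₀ k : ℕ, t₀ + k ≤ T →
          A.HasRegretBound t₀ k
            (C * Real.sqrt ((Metric.diam (Set.univ : Set X) + 1) * (k : ℝ) *
              Real.log ((Fintype.card X : ℝ) * (T : ℝ)))) := by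
  refine ⟨147, by norm_num, fun X _ _ _ M T => ?_⟩
  simp only [mul_right_comm _ (Nat.cast _ : ℝ) (Real.log _)]
  have hs : 1 ≤ Metric.diam (Set.univ : Set X) + 1 := le_add_of_nonneg_left Metric.diam_nonneg
  rcases subsingleton_or_nontrivial X with _ | _
  · exact ⟨_, fun t₀ k h => (MetricalTaskSystem.hasRegretBound_zero_of_subsingleton M
      (Classical.arbitrary X) h).mono (by positivity)⟩
  rcases le_or_gt (T : ℝ)
    ((Metric.diam (Set.univ : Set X) + 1) * Real.log (Fintype.card X * T)) with hT | hT
  · refine ⟨_, fun t₀ k h =>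
      (MetricalTaskSystem.hasRegretBound_followMarginals_pure M (Classical.arbitrary X) h).mono ?_⟩
    have hkT : (k : ℝ) ≤ T := by exact_mod_cast (Nat.le_add_left k t₀).trans h
    exact (MetricalTaskSystem.le_sqrt_mul_self k.cast_nonneg (hkT.trans hT)).trans
      (le_mul_of_one_le_left (Real.sqrt_nonneg _) (by norm_num))
  · exact ⟨_, fun t₀ k h => MetricalTaskSystem.hasRegretBound_multirate_sqrt M hs
      (le_add_of_nonneg_right zero_le_one) hT h⟩
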